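/- Let $R$ be an associative ring with identity. Call a submodule $N$ of a right $R$-module $M$ essential if it intersects every nonzero submodule of $M$ nontrivially, and call a module uniform if it is nonzero and any two of its nonzero submodules have nonzero intersection. Call $R$ right finite dimensional if $R_R$ has finite Goldie dimension, i.e. for some integer $n \ge 0$ there is an essential submodule of $R_R$ that is a direct sum of $n$ uniform submodules. Call $R$ right FP-injective if for every free right $R$-module $F$ and every finitely generated submodule $N$ of $F$, every $R$-homomorphism $N \to R_R$ extends to an $R$-homomorphism $F \to R_R$; call $R$ right self-injective if $R_R$ is an injective right $R$-module; and call $R$ semilocal if $R/J(R)$ is a semisimple ring, where $J(R)$ is the Jacobson radical of $R$. If $R$ is right FP-injective or right self-injective, then $R$ is semilocal if and only if $R$ is right finite dimensional. -/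

import Mathlib

universe u

/-- `N` is an essential submodule of `M`: it meets every nonzero submodule of `M` nontrivially. -/
def IsEssentialSubmodule {S M : Type*} [Ring S] [AddCommGroup M] [Module S M]
    (N : Submodule S M) : Prop :=
  ∀ L : Submodule S M, L ≠ ⊥ → N ⊓ L ≠ ⊥

/-- `U` is a uniform submodule of `M`: it is nonzero and any two nonzero submodules of `U`
have nonzero intersection. -/
def IsUniformSubmodule {S M : Type*} [Ring S] [AddCommGroup M] [Module S M]
    (U : Submodule S M) : Prop :=
  U ≠ ⊥ ∧ ∀ A B : Submodule S M, A ≤ U → B ≤ U → A ≠ ⊥ → B ≠ ⊥ → A ⊓ B ≠ ⊥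

/-- `M` has Goldie dimension `n`: some essential submodule of `M` is the (internal) direct sum
of `n` uniform submodules. -/
def HasGoldieDim (S M : Type*) [Ring S] [AddCommGroup M] [Module S M] (n : ℕ) : Prop :=
  ∃ U : Fin n → Submodule S M,
    (∀ i, IsUniformSubmodule (U i)) ∧ iSupIndep U ∧ IsEssentialSubmodule (⨆ i, U i)

/-- `M` is finite dimensional: its Goldie dimension is finite. -/
def IsGoldieFiniteDimensional (S M : Type*) [Ring S] [AddCommGroup M] [Module S M] : Prop :=
  ∃ n : ℕ, HasGoldieDim S M n

/-- `R` is right finite dimensional: `R` has finite Goldie dimension as a right module over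
itself. Right `R`-modules are modules over `Rᵐᵒᵖ`. -/
def IsRightFiniteDimensional (R : Type*) [Ring R] : Prop :=
  IsGoldieFiniteDimensional Rᵐᵒᵖ R

/-- `R` is right FP-injective: every homomorphism to `R` from a finitely generated submodule `N`
of a free right `R`-module `F` extends to `F`. -/
def IsRightFPInjective (R : Type u) [Ring R] : Prop :=
  ∀ (F : Type u) [AddCommGroup F] [Module Rᵐᵒᵖ F] [Module.Free Rᵐᵒᵖ F]
    (N : Submodule Rᵐᵒᵖ F), N.FG → ∀ f : N →ₗ[Rᵐᵒᵖ] R,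
      ∃ g : F →ₗ[Rᵐᵒᵖ] R, ∀ x : N, g x = f x

/-- `R` is right self-injective: it is injective as a right module over itself. -/
def IsRightSelfInjective (R : Type*) [Ring R] : Prop :=
  Module.Injective Rᵐᵒᵖ R

/-- `R` is semilocal: `R ⧸ J(R)` is a semisimple ring, where `J(R)` is the Jacobson radical. -/
def IsSemilocalRing (R : Type*) [Ring R] : Prop :=
  IsSemisimpleRing (R ⧸ Ring.jacobson R)

/-! Either hypothesis makes every map to `R` from a finitely generated right ideal a left
multiplication (`ExtendsFromFGRightIdeals`); only this is used afterwards.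

Finite dimensional implies semilocal: if `a` has zero right annihilator, it has a left inverse `b`,
and `aR ≅ R` is essential by finite dimension, so `b` also has zero right annihilator and `a` is a
unit (`isUnit`). Given a left ideal `I`, take `c` with `I + Rc = R` whose right annihilator is as
large as possible; maximality forces `I ∩ Rc ⊆ J(R)`, so left ideals of `R/J(R)` have complements
(`exists_complement_modulo_jacobson`).

Semilocal implies finite dimensional: `k` independent nonzero right ideals yield, by extending
projections, a surjection of `R/J(R)` onto a product of `k` simple left modules, so `k` is at most
the length of `R/J(R)` (`card_le_length_of_dual`). -/

section Lattice

variable {α : Type*} [CompleteLattice α] [IsModularLattice α]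

theorem iSupIndep.update {ι : Type*} [DecidableEq ι] {V : ι → α} (hV : iSupIndep V) {j : ι} {X : α}
    (hX : Disjoint X (⨆ (i) (_ : i ≠ j), V i)) : iSupIndep (Function.update V j X) := by
  intro i
  by_cases hij : i = j
  · subst hij
    rw [Function.update_self]
    refine hX.mono_right (iSup₂_mono fun k hk => ?_)
    rw [Function.update_of_ne hk]
  · rw [Function.update_of_ne hij]
    have h₁ : Disjoint (V i) (⨆ (k) (_ : k ≠ i ∧ k ≠ j), V k) :=
      (hV i).mono_right (iSup₂_le fun k hk => le_iSup₂_of_le k hk.1 le_rfl)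
    have h₂ : Disjoint (V i ⊔ ⨆ (k) (_ : k ≠ i ∧ k ≠ j), V k) X :=
      hX.symm.mono_left (sup_le (le_iSup₂_of_le i hij le_rfl)
        (iSup₂_le fun k hk => le_iSup₂_of_le k hk.2 le_rfl))
    refine (h₁.disjoint_sup_right_of_disjoint_sup_left h₂).mono_right (iSup₂_le fun k hk => ?_)
    by_cases hkj : k = j
    · subst hkj
      rw [Function.update_self]
      exact le_sup_right
    · rw [Function.update_of_ne hkj]
      exact le_sup_of_le_left (le_iSup₂_of_le k ⟨hk, hkj⟩ le_rfl)

theorem iSupIndep.cons {n : ℕ} {V : Fin n → α} (hV : iSupIndep V) {X : α}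
    (hX : Disjoint X (⨆ i, V i)) : iSupIndep (Fin.cons X V : Fin (n + 1) → α) := by
  intro i
  induction i using Fin.cases with
  | zero =>
    refine hX.mono_right (iSup₂_le fun k hk => ?_)
    obtain ⟨k, rfl⟩ := Fin.exists_succ_eq.2 hk
    exact le_iSup V k
  | succ i =>
    have h₂ : Disjoint (V i ⊔ ⨆ (k) (_ : k ≠ i), V k) X :=
      hX.symm.mono_left (sup_le (le_iSup V i) (iSup₂_le fun k _ => le_iSup V k))
    refine ((hV i).disjoint_sup_right_of_disjoint_sup_left h₂).mono_right
      (iSup₂_le fun k hk => ?_)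
    induction k using Fin.cases with
    | zero => exact le_sup_right
    | succ k =>
      exact le_sup_of_le_left (le_iSup₂_of_le k (fun h => hk (congrArg Fin.succ h)) le_rfl)

end Lattice

/-! ### Goldie dimension as a bound on independent families. -/

section Goldie

variable {S M : Type*} [Ring S] [AddCommGroup M] [Module S M]

/-- `N` contains the direct sum of `k` nonzero submodules. -/
def HasIndepFamily (N : Submodule S M) (k : ℕ) : Prop :=
  ∃ V : Fin k → Submodule S M, iSupIndep V ∧ (∀ i, V i ≠ ⊥) ∧ ∀ i, V i ≤ N

theorem hasIndepFamily_zero (N : Submodule S M) : HasIndepFamily N 0 :=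
  ⟨fun _ => ⊥, iSupIndep_subsingleton _, fun i => i.elim0, fun i => i.elim0⟩

theorem HasIndepFamily.succ {N Q P : Submodule S M} {k : ℕ} (h : HasIndepFamily N k)
    (hd : Disjoint N Q) (hQ : Q ≠ ⊥) (hN : N ≤ P) (hQP : Q ≤ P) : HasIndepFamily P (k + 1) := by
  obtain ⟨V, hV, hV0, hVN⟩ := h
  refine ⟨Fin.cons Q V, hV.cons (hd.symm.mono_right (iSup_le hVN)), fun i => ?_, fun i => ?_⟩
  · induction i using Fin.cases with
    | zero => exact hQ
    | succ i => exact hV0 i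
  · induction i using Fin.cases with
    | zero => exact hQP
    | succ i => exact (hVN i).trans hN

theorem HasIndepFamily.map {N : Submodule S M} {k : ℕ} (h : HasIndepFamily N k)
    {f : M →ₗ[S] M} (hf : Function.Injective f) : HasIndepFamily (N.map f) k := by
  obtain ⟨V, hV, hV0, hVN⟩ := h
  refine ⟨fun i => (V i).map f, fun i => ?_, fun i => ?_, fun i => Submodule.map_mono (hVN i)⟩
  · simp only [← Submodule.map_iSup]
    exact Submodule.disjoint_map hf (hV i)
  · exact fun h0 => hV0 i (Submodule.map_injective_of_injective hf
      (h0.trans (Submodule.map_bot f).symm))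

/-- Uniformity of `U i` lets a multiple bring one component into `W`; a further multiple treats the
remaining components, and independence prevents cancellation. -/
theorem exists_smul_mem_of_mem_biSup_uniform {ι : Type*} {U : ι → Submodule S M}
    (hU : ∀ i, IsUniformSubmodule (U i)) (ind : iSupIndep U) {W : Submodule S M}
    (hW : ∀ i, U i ⊓ W ≠ ⊥) (s : Finset ι) :
    ∀ x ∈ ⨆ i ∈ s, U i, x ≠ 0 → ∃ r : S, r • x ≠ 0 ∧ r • x ∈ W := by
  classical
  induction s using Finset.induction_on with
  | empty => intro x hx hx0; simp at hx; exact absurd hx hx0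
  | insert i s his ih =>
    intro x hx hx0
    rw [Finset.iSup_insert] at hx
    obtain ⟨u, hu, y, hy, rfl⟩ := Submodule.mem_sup.1 hx
    have hdis : Disjoint (U i) (⨆ j ∈ s, U j) := ind.disjoint_biSup (by simpa using his)
    by_cases hu0 : u = 0
    · subst hu0
      rw [zero_add] at hx0 ⊢
      exact ih y hy hx0
    have hne := (hU i).2 (Submodule.span S {u}) (U i ⊓ W)
      ((Submodule.span_singleton_le_iff_mem _ _).2 hu) inf_le_left
      (by simpa using hu0) (hW i)
    obtain ⟨v, hv, hv0⟩ := (Submodule.ne_bot_iff _).1 hne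
    obtain ⟨hv₁, hvU, hvW⟩ := hv
    obtain ⟨r, rfl⟩ := Submodule.mem_span_singleton.1 hv₁
    by_cases hry : r • y = 0
    · refine ⟨r, ?_, ?_⟩
      · rwa [smul_add, hry, add_zero]
      · rwa [smul_add, hry, add_zero]
    · obtain ⟨t, ht0, htW⟩ := ih (r • y) (Submodule.smul_mem _ _ hy) hry
      refine ⟨t * r, fun h0 => ht0 ?_, ?_⟩
      · rw [mul_smul, smul_add, smul_add] at h0
        refine Submodule.disjoint_def.1 hdis _ ?_ ?_
        · rw [eq_neg_of_add_eq_zero_right h0]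
          exact neg_mem (Submodule.smul_mem _ _ hvU)
        · exact Submodule.smul_mem _ _ (Submodule.smul_mem _ _ hy)
      · rw [mul_smul, smul_add, smul_add]
        exact add_mem (Submodule.smul_mem _ _ hvW) htW

theorem isEssentialSubmodule_of_inf_uniform_ne_bot {ι : Type*} [Fintype ι]
    {U : ι → Submodule S M} (hU : ∀ i, IsUniformSubmodule (U i)) (ind : iSupIndep U)
    (hess : IsEssentialSubmodule (⨆ i, U i)) {W : Submodule S M} (hW : ∀ i, U i ⊓ W ≠ ⊥) :
    IsEssentialSubmodule W := by
  intro L hL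
  obtain ⟨x, ⟨hxU, hxL⟩, hx0⟩ := (Submodule.ne_bot_iff _).1 (hess L hL)
  obtain ⟨r, hr0, hrW⟩ := exists_smul_mem_of_mem_biSup_uniform hU ind hW Finset.univ x
    (by simpa using hxU) hx0
  exact (Submodule.ne_bot_iff _).2 ⟨r • x, ⟨hrW, Submodule.smul_mem _ _ hxL⟩, hr0⟩

/-- Steinitz exchange: the members of the family are replaced one at a time by members of `U`. The
final family is independent with nonzero terms, so it uses distinct indices. -/
theorem HasGoldieDim.le_of_hasIndepFamily {n k : ℕ} (h : HasGoldieDim S M n)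
    {N : Submodule S M} (hk : HasIndepFamily N k) : k ≤ n := by
  classical
  obtain ⟨U, hU, ind, hess⟩ := h
  obtain ⟨V, hV, hV0, -⟩ := hk
  have key : ∀ T : Finset (Fin k), ∃ W : Fin k → Submodule S M, iSupIndep W ∧ (∀ i, W i ≠ ⊥) ∧
      ∀ i ∈ T, ∃ j, W i = U j := by
    intro T
    induction T using Finset.induction_on with
    | empty => exact ⟨V, hV, hV0, by simp⟩
    | insert a T haT ih =>
      obtain ⟨W, hW, hW0, hWT⟩ := ih
      -- Otherwise the sum of the other `W i` would be essential, although it misses `W a`.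
      obtain ⟨j, hj⟩ : ∃ j, U j ⊓ (⨆ (i) (_ : i ≠ a), W i) = ⊥ := by
        by_contra! hcon
        refine isEssentialSubmodule_of_inf_uniform_ne_bot hU ind hess hcon (W a) (hW0 a) ?_
        rw [inf_comm]
        exact (hW a).eq_bot
      refine ⟨Function.update W a (U j), hW.update (disjoint_iff.2 hj), fun i => ?_,
        fun i hi => ?_⟩
      · by_cases hia : i = a
        · subst hia; rw [Function.update_self]; exact (hU j).1
        · rw [Function.update_of_ne hia]; exact hW0 i
      · by_cases hia : i = a
        · subst hia; exact ⟨j, Function.update_self ..⟩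
        · rw [Function.update_of_ne hia]
          exact hWT i (Finset.mem_of_mem_insert_of_ne hi hia)
  obtain ⟨W, hW, hW0, hWU⟩ := key Finset.univ
  choose f hf using fun i => hWU i (Finset.mem_univ i)
  have hinj : Function.Injective f := fun i j hij =>
    hW.injective hW0 (by rw [hf i, hf j, hij])
  simpa using Fintype.card_le_of_injective f hinj

/-- An independent family of maximal length works: a non-uniform term could be split in two, and a
submodule missing the sum could be adjoined. -/
theorem isGoldieFiniteDimensional_of_hasIndepFamily_bounded {n : ℕ}
    (hn : ∀ k, HasIndepFamily (⊤ : Submodule S M) k → k ≤ n) : IsGoldieFiniteDimensional S M := by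
  have hbdd : BddAbove {k | HasIndepFamily (⊤ : Submodule S M) k} := ⟨n, hn⟩
  have hmem := Nat.sSup_mem ⟨0, hasIndepFamily_zero (⊤ : Submodule S M)⟩ hbdd
  set m := sSup {k | HasIndepFamily (⊤ : Submodule S M) k} with hm
  have hmax : ¬ HasIndepFamily (⊤ : Submodule S M) (m + 1) := fun h =>
    absurd (le_csSup hbdd h) (by rw [← hm]; omega)
  obtain ⟨V, hV, hV0, -⟩ := hmem
  refine ⟨m, V, fun i => ⟨hV0 i, fun A B hA hB hA0 hB0 hAB => hmax ?_⟩, hV, fun L hL h0 => hmax ?_⟩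
  · have h₁ : Disjoint A (⨆ (j) (_ : j ≠ i), V j) := (hV i).mono_left hA
    have h₂ : Disjoint B (A ⊔ ⨆ (j) (_ : j ≠ i), V j) :=
      (disjoint_iff.2 hAB).symm.disjoint_sup_right_of_disjoint_sup_left
        ((hV i).mono_left (sup_le hB hA))
    refine HasIndepFamily.succ (N := A ⊔ ⨆ (j) (_ : j ≠ i), V j)
      ⟨Function.update V i A, hV.update h₁, fun j => ?_, fun j => ?_⟩ h₂.symm hB0 le_top le_top
    · by_cases hji : j = i
      · subst hji; rwa [Function.update_self]
      · rw [Function.update_of_ne hji]; exact hV0 j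
    · by_cases hji : j = i
      · subst hji; rw [Function.update_self]; exact le_sup_left
      · rw [Function.update_of_ne hji]
        exact le_sup_of_le_right (le_iSup₂_of_le j hji le_rfl)
  · exact HasIndepFamily.succ (N := ⨆ i, V i) ⟨V, hV, hV0, fun i => le_iSup V i⟩
      (disjoint_iff.2 h0) hL le_top le_top

/-- If `L` missed the range, applying `f` to an independent family and adjoining `L` would lengthen
it indefinitely. -/
theorem isEssentialSubmodule_range_of_injective {n : ℕ}
    (hn : ∀ k, HasIndepFamily (⊤ : Submodule S M) k → k ≤ n) {f : M →ₗ[S] M}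
    (hf : Function.Injective f) : IsEssentialSubmodule (LinearMap.range f) := by
  intro L hL h0
  have key : ∀ k, HasIndepFamily (⊤ : Submodule S M) k := by
    intro k
    induction k with
    | zero => exact hasIndepFamily_zero _
    | succ k ih =>
      have := ih.map hf
      rw [Submodule.map_top] at this
      exact this.succ (disjoint_iff.2 h0) hL le_top le_top
  have := hn _ (key (n + 1))
  omega

end Goldie

/-! ### Left multiplications, right annihilators and units. -/

section Ring

variable {R : Type*} [Ring R]

/-- Left multiplication by `a`, as an endomorphism of the right module `R`. -/
def rightModuleMulLeft (a : R) : R →ₗ[Rᵐᵒᵖ] R where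
  toFun x := a * x
  map_add' := mul_add a
  map_smul' r x := by simp [mul_assoc]

@[simp]
theorem rightModuleMulLeft_apply (a x : R) : rightModuleMulLeft a x = a * x := rfl

/-- Every homomorphism to `R` from a finitely generated right ideal is a left multiplication. -/
def ExtendsFromFGRightIdeals (R : Type*) [Ring R] : Prop :=
  ∀ N : Submodule Rᵐᵒᵖ R, N.FG → ∀ f : N →ₗ[Rᵐᵒᵖ] R, ∃ e : R, ∀ x : N, e * x = f x

theorem extendsFromFGRightIdeals_of_forall_exists
    (h : ∀ N : Submodule Rᵐᵒᵖ R, N.FG → ∀ f : N →ₗ[Rᵐᵒᵖ] R, ∃ g : R →ₗ[Rᵐᵒᵖ] R, ∀ x : N, g x = f x) :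
    ExtendsFromFGRightIdeals R := by
  intro N hN f
  obtain ⟨g, hg⟩ := h N hN f
  refine ⟨g 1, fun x => ?_⟩
  rw [← hg]
  simpa using (g.map_smul (MulOpposite.op (x : R)) 1).symm

theorem IsRightFPInjective.extendsFromFGRightIdeals (h : IsRightFPInjective R) :
    ExtendsFromFGRightIdeals R :=
  have : Module.Free Rᵐᵒᵖ R := Module.Free.of_equiv
    ({ MulOpposite.opAddEquiv.symm with map_smul' := fun _ _ => rfl } : Rᵐᵒᵖ ≃ₗ[Rᵐᵒᵖ] R)
  extendsFromFGRightIdeals_of_forall_exists fun N hN f => h R N hN f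

theorem IsRightSelfInjective.extendsFromFGRightIdeals (h : IsRightSelfInjective R) :
    ExtendsFromFGRightIdeals R :=
  extendsFromFGRightIdeals_of_forall_exists fun N _ f =>
    h.out N.subtype N.subtype_injective f

theorem ExtendsFromFGRightIdeals.exists_mul_eq_one (h : ExtendsFromFGRightIdeals R) {a : R}
    (ha : LinearMap.ker (rightModuleMulLeft a) = ⊥) : ∃ b, b * a = 1 := by
  let e := LinearEquiv.ofInjective (rightModuleMulLeft a) (LinearMap.ker_eq_bot.1 ha)
  have hfg : (LinearMap.range (rightModuleMulLeft a)).FG := by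
    refine ⟨{a}, le_antisymm ?_ ?_⟩
    · simpa using ⟨1, by simp⟩
    · rintro _ ⟨x, rfl⟩
      rw [Finset.coe_singleton]
      exact Submodule.mem_span_singleton.2 ⟨MulOpposite.op x, rfl⟩
  -- The inverse map `aR → R` is itself left multiplication by some `b`.
  obtain ⟨b, hb⟩ := h _ hfg e.symm.toLinearMap
  refine ⟨b, ?_⟩
  have := hb (e 1)
  simpa [e] using this

theorem ExtendsFromFGRightIdeals.isUnit (h : ExtendsFromFGRightIdeals R) {n : ℕ}
    (hn : ∀ k, HasIndepFamily (⊤ : Submodule Rᵐᵒᵖ R) k → k ≤ n) {a : R}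
    (ha : LinearMap.ker (rightModuleMulLeft a) = ⊥) : IsUnit a := by
  obtain ⟨b, hba⟩ := h.exists_mul_eq_one ha
  have hess := isEssentialSubmodule_range_of_injective hn (LinearMap.ker_eq_bot.1 ha)
  have hbot : LinearMap.ker (rightModuleMulLeft b) = ⊥ := by
    by_contra hne
    refine hess _ hne ((Submodule.eq_bot_iff _).2 ?_)
    rintro _ ⟨⟨x, rfl⟩, hx⟩
    have hx : b * (a * x) = 0 := hx
    rw [← mul_assoc, hba, one_mul] at hx
    simp [hx]
  have hab : a * b = 1 := by
    have : a * b - 1 ∈ LinearMap.ker (rightModuleMulLeft b) := by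
      simp [mul_sub, ← mul_assoc, hba]
    rw [hbot] at this
    exact sub_eq_zero.1 this
  exact ⟨⟨a, b, hab, hba⟩, rfl⟩

/-- Since `a - aba = a(1 - ba)`, it kills both annihilators; these are disjoint because `ax = 0` and
`(1 - ba)x = 0` give `x = 0`. -/
theorem hasIndepFamily_ker_sub {a b : R} {k : ℕ}
    (hk : HasIndepFamily (LinearMap.ker (rightModuleMulLeft a)) k)
    (hb : LinearMap.ker (rightModuleMulLeft (1 - b * a)) ≠ ⊥) :
    HasIndepFamily (LinearMap.ker (rightModuleMulLeft (a - a * b * a))) (k + 1) := by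
  refine hk.succ (Q := LinearMap.ker (rightModuleMulLeft (1 - b * a))) ?_ hb ?_ ?_
  · rw [Submodule.disjoint_def]
    intro x hx hx'
    simp only [LinearMap.mem_ker, rightModuleMulLeft_apply] at hx hx'
    simpa [sub_mul, mul_assoc, hx] using hx'
  · intro x hx
    simp only [LinearMap.mem_ker, rightModuleMulLeft_apply] at hx ⊢
    simp [sub_mul, mul_assoc, hx]
  · intro x hx
    simp only [LinearMap.mem_ker, rightModuleMulLeft_apply] at hx ⊢
    rw [show a - a * b * a = a * (1 - b * a) by noncomm_ring, mul_assoc, hx, mul_zero]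

/-! ### From finite dimension to semilocality. -/

theorem mem_jacobson_of_forall_isUnit {x : R} (hx : ∀ b, IsUnit (1 - b * x)) :
    x ∈ Ring.jacobson R := by
  rw [← Ideal.jacobson_bot, Ideal.mem_jacobson_iff]
  intro y
  obtain ⟨u, hu⟩ := hx (-y)
  refine ⟨↑u⁻¹, ?_⟩
  have : (↑u⁻¹ : R) * (1 - -y * x) = 1 := by rw [← hu]; exact u.inv_mul
  rw [Ideal.mem_bot, ← this]
  noncomm_ring

/-- Every left ideal has a complement modulo the Jacobson radical, of the form `R * c` where `c`
has a right annihilator of largest uniform dimension. -/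
theorem exists_complement_modulo_jacobson {n : ℕ}
    (hn : ∀ k, HasIndepFamily (⊤ : Submodule Rᵐᵒᵖ R) k → k ≤ n)
    (hunit : ∀ a : R, LinearMap.ker (rightModuleMulLeft a) = ⊥ → IsUnit a) (I : Ideal R) :
    ∃ c : R, (∃ i ∈ I, ∃ r, i + r * c = 1) ∧ ∀ s, s * c ∈ I → s * c ∈ Ring.jacobson R := by
  let D : Set ℕ := {k | ∃ c : R, (∃ i ∈ I, ∃ r, i + r * c = 1) ∧
    HasIndepFamily (LinearMap.ker (rightModuleMulLeft c)) k}
  have hD : BddAbove D := by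
    refine ⟨n, ?_⟩
    rintro k ⟨c, -, V, hV, hV0, -⟩
    exact hn k ⟨V, hV, hV0, fun _ => le_top⟩
  have hne : D.Nonempty := ⟨0, 1, ⟨0, I.zero_mem, 1, by simp⟩, hasIndepFamily_zero _⟩
  obtain ⟨c, ⟨i, hi, r, hir⟩, hc⟩ := Nat.sSup_mem hne hD
  refine ⟨c, ⟨i, hi, r, hir⟩, fun s hs => mem_jacobson_of_forall_isUnit fun b => ?_⟩
  by_contra hnu
  -- Replacing `c` by `c - cbsc` changes it by a multiple of `sc ∈ I`, so it still generates `R`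
  -- together with `I`, but its annihilator contains a longer independent family.
  have hmem : sSup D + 1 ∈ D := by
    refine ⟨c - c * (b * s) * c, ⟨i + r * c * b * (s * c), I.add_mem hi (I.mul_mem_left _ hs), r, ?_⟩,
      hasIndepFamily_ker_sub hc fun h => hnu ?_⟩
    · rw [← hir]; noncomm_ring
    · simpa [mul_assoc] using hunit _ h
  have := le_csSup hD hmem
  omega

theorem isSemilocalRing_of_hasIndepFamily_bounded {n : ℕ}
    (hn : ∀ k, HasIndepFamily (⊤ : Submodule Rᵐᵒᵖ R) k → k ≤ n)
    (hunit : ∀ a : R, LinearMap.ker (rightModuleMulLeft a) = ⊥ → IsUnit a) :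
    IsSemilocalRing R := by
  let q := Ideal.Quotient.mk (Ring.jacobson R)
  have : ComplementedLattice (Ideal (R ⧸ Ring.jacobson R)) := by
    refine ⟨fun I => ?_⟩
    obtain ⟨c, ⟨i, hi, r, hir⟩, hc⟩ := exists_complement_modulo_jacobson hn hunit (I.comap q)
    refine ⟨Ideal.span {q c}, ?_, ?_⟩
    · rw [Submodule.disjoint_def]
      intro x hxI hx
      obtain ⟨s, rfl⟩ := Ideal.mem_span_singleton'.1 hx
      obtain ⟨s, rfl⟩ := Ideal.Quotient.mk_surjective s
      rw [← map_mul]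
      refine Ideal.Quotient.eq_zero_iff_mem.2 (hc s ?_)
      rw [Ideal.mem_comap, map_mul]
      exact hxI
    · rw [codisjoint_iff, Ideal.eq_top_iff_one, ← map_one q, ← hir, map_add, map_mul]
      exact Submodule.add_mem_sup hi (Ideal.mul_mem_left _ _ (Ideal.mem_span_singleton_self _))
  exact (isSemisimpleModule_iff _ _).2 this

/-! ### From semilocality to finite dimension. -/

theorem ExtendsFromFGRightIdeals.exists_separating (h : ExtendsFromFGRightIdeals R)
    {P Q : Submodule Rᵐᵒᵖ R} (hP : P.FG) (hQ : Q.FG) (hd : Disjoint P Q) :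
    ∃ e : R, (∀ x ∈ P, e * x = x) ∧ ∀ x ∈ Q, e * x = 0 := by
  let f : R →ₗ.[Rᵐᵒᵖ] R := ⟨P, P.subtype⟩
  let g : R →ₗ.[Rᵐᵒᵖ] R := ⟨Q, 0⟩
  have hfg := LinearPMap.sup_h_of_disjoint f g hd
  -- The extended map is the projection of `P ⊕ Q` onto `P`.
  obtain ⟨e, he⟩ := h (P ⊔ Q) (hP.sup hQ) (f.sup g hfg).toFun
  refine ⟨e, fun x hx => ?_, fun x hx => ?_⟩
  · have h₁ := LinearPMap.sup_apply hfg ⟨x, hx⟩ 0 ⟨x, Submodule.mem_sup_left hx⟩ (by simp)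
    exact (he ⟨x, Submodule.mem_sup_left hx⟩).trans (h₁.trans (add_zero x))
  · have h₁ := LinearPMap.sup_apply hfg 0 ⟨x, hx⟩ ⟨x, Submodule.mem_sup_right hx⟩ (by simp)
    exact (he ⟨x, Submodule.mem_sup_right hx⟩).trans (h₁.trans (zero_add (0 : R)))

theorem ExtendsFromFGRightIdeals.exists_dual (h : ExtendsFromFGRightIdeals R) {ι : Type*}
    [Finite ι] {V : ι → Submodule Rᵐᵒᵖ R} (hV : iSupIndep V) {a : ι → R} (ha : ∀ i, a i ∈ V i)
    (i : ι) : ∃ e : R, e * a i = a i ∧ ∀ j ≠ i, e * a j = 0 := by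
  have hle : Submodule.span Rᵐᵒᵖ (a '' {j | j ≠ i}) ≤ ⨆ (j) (_ : j ≠ i), V j := by
    refine Submodule.span_le.2 ?_
    rintro _ ⟨j, hj, rfl⟩
    exact (le_iSup₂_of_le (f := fun j (_ : j ≠ i) => V j) j hj le_rfl) (ha j)
  obtain ⟨e, h₁, h₂⟩ := h.exists_separating (Submodule.fg_span_singleton (a i))
    (Submodule.fg_span (Set.toFinite (a '' {j | j ≠ i})))
    ((hV i).mono ((Submodule.span_singleton_le_iff_mem _ _).2 (ha i)) hle)
  exact ⟨e, h₁ _ (Submodule.mem_span_singleton_self _),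
    fun j hj => h₂ _ (Submodule.subset_span ⟨j, hj, rfl⟩)⟩

/-- Chinese remainder argument for left ideals: modulo `m j`, the sum of the `r i * e i` reduces to
`r j`. -/
theorem surjective_pi_mkQ_of_dual {ι : Type*} [Fintype ι] (m : ι → Ideal R) (e : ι → R)
    (h₁ : ∀ i, 1 - e i ∈ m i) (h₂ : ∀ i j, i ≠ j → e i ∈ m j) :
    Function.Surjective (LinearMap.pi fun i => (m i).mkQ) := by
  intro y
  choose r hr using fun i => (m i).mkQ_surjective (y i)
  refine ⟨∑ i, r i * e i, funext fun j => ?_⟩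
  rw [LinearMap.pi_apply, ← hr j]
  refine (Submodule.Quotient.eq _).2 ?_
  classical
  rw [← Finset.add_sum_erase _ _ (Finset.mem_univ j), add_sub_right_comm]
  refine add_mem ?_ (sum_mem fun i hi => (m j).mul_mem_left _ (h₂ i j (Finset.ne_of_mem_erase hi)))
  rw [show r j * e j - r j = -(r j * (1 - e j)) by noncomm_ring]
  exact neg_mem ((m j).mul_mem_left _ (h₁ j))

/-- Length is taken over `R`, so that it can be compared with the quotients `R ⧸ m i`; the identity
map, semilinear along `R → R/J(R)`, transfers finiteness. -/
theorem IsSemilocalRing.length_ne_top (h : IsSemilocalRing R) :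
    Module.length R (R ⧸ Ring.jacobson R) ≠ ⊤ := by
  have : IsSemisimpleRing (R ⧸ Ring.jacobson R) := h
  let f : (R ⧸ Ring.jacobson R) →ₛₗ[Ideal.Quotient.mk (Ring.jacobson R)] (R ⧸ Ring.jacobson R) :=
    { toFun := id
      map_add' := fun _ _ => rfl
      map_smul' := fun r x => by
        obtain ⟨x, rfl⟩ := Ideal.Quotient.mk_surjective x
        rfl }
  have h₁ : IsNoetherian R (R ⧸ Ring.jacobson R) :=
    (f.isNoetherian_iff_of_bijective Function.bijective_id).2 inferInstance
  have h₂ : IsArtinian R (R ⧸ Ring.jacobson R) :=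
    (f.isArtinian_iff_of_bijective Function.bijective_id).2 inferInstance
  exact Module.length_ne_top

theorem card_le_length_of_dual {k : ℕ} {a e : Fin k → R} (ha : ∀ i, a i ≠ 0)
    (h₁ : ∀ i, e i * a i = a i) (h₂ : ∀ i j, j ≠ i → e i * a j = 0) :
    (k : ℕ∞) ≤ Module.length R (R ⧸ Ring.jacobson R) := by
  -- This kernel is the left annihilator of `a i`: it contains `1 - e i`, and every `e j` with `j ≠
  -- i`.
  have hker : ∀ i, LinearMap.ker (LinearMap.toSpanSingleton R R (a i)) ≠ ⊤ := fun i htop =>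
    ha i (by simpa using (Ideal.eq_top_iff_one _).1 htop)
  choose m hm hle using fun i => Ideal.exists_le_maximal _ (hker i)
  have hsurj := surjective_pi_mkQ_of_dual m e
    (fun i => hle i (by simp [sub_mul, h₁ i])) fun i j hij => hle j (by simp [h₂ i j hij.symm])
  have hJ : Ring.jacobson R ≤ LinearMap.ker (LinearMap.pi fun i => (m i).mkQ) := by
    rw [LinearMap.ker_pi]
    refine le_iInf fun i => ?_
    rw [Submodule.ker_mkQ]
    exact sInf_le (hm i).out
  have hlen := Module.length_le_of_surjective ((Ring.jacobson R).liftQ _ hJ) (by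
    rw [← LinearMap.range_eq_top, Submodule.range_liftQ, LinearMap.range_eq_top]
    exact hsurj)
  have hsimple : ∀ i, IsSimpleModule R (R ⧸ m i) := fun i => isSimpleModule_iff_isCoatom.2 (hm i).out
  simpa [Module.length_pi_of_fintype, Module.length_eq_one] using hlen

theorem ExtendsFromFGRightIdeals.isRightFiniteDimensional (h : ExtendsFromFGRightIdeals R)
    (hs : IsSemilocalRing R) : IsRightFiniteDimensional R := by
  obtain ⟨n, hn⟩ := ENat.ne_top_iff_exists.1 hs.length_ne_top
  refine isGoldieFiniteDimensional_of_hasIndepFamily_bounded (n := n) ?_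
  rintro k ⟨V, hV, hV0, -⟩
  choose a haV ha0 using fun i => (Submodule.ne_bot_iff _).1 (hV0 i)
  choose e he₁ he₂ using h.exists_dual hV haV
  have := card_le_length_of_dual ha0 he₁ he₂
  rw [← hn] at this
  exact_mod_cast this

theorem ExtendsFromFGRightIdeals.isSemilocalRing (h : ExtendsFromFGRightIdeals R)
    (hd : IsRightFiniteDimensional R) : IsSemilocalRing R := by
  obtain ⟨n, hn⟩ := hd
  have hbound : ∀ k, HasIndepFamily (⊤ : Submodule Rᵐᵒᵖ R) k → k ≤ n :=
    fun k hk => hn.le_of_hasIndepFamily hk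
  exact isSemilocalRing_of_hasIndepFamily_bounded hbound fun a ha => h.isUnit hbound ha

end Ring

theorem corollary3p5 {R : Type*} [Ring R]
    (hR : IsRightFPInjective R ∨ IsRightSelfInjective R) :
    IsSemilocalRing R ↔ IsRightFiniteDimensional R := by
  have h : ExtendsFromFGRightIdeals R :=
    hR.elim (fun h => h.extendsFromFGRightIdeals) fun h => h.extendsFromFGRightIdeals
  exact ⟨h.isRightFiniteDimensional, h.isSemilocalRing⟩
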